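/- Let $A$ be a unital C*-algebra, $P\subseteq A$ a C*-subalgebra containing $1_A$, and $E\colon A\to P$ a conditional expectation (a positive contractive linear $P$-bimodule map with $E|_P=\mathrm{id}$) of index-finite type, i.e. there are $u_1,v_1,\dots,u_n,v_n\in A$ with $x=\sum_i u_iE(v_ix)=\sum_i E(xu_i)v_i$ for all $x\in A$; put $\operatorname{Index}E=\sum_i u_iv_i\in A$, which does not depend on the choice of the $u_i,v_i$. Let $A^\infty=\ell^\infty(\mathbb N,A)/c_0(\mathbb N,A)$, in which $A$ is embedded as constant sequences, and let $E^\infty\colon A^\infty\to A^\infty$ be the map $[(x_n)]\mapsto[(E(x_n))]$. Suppose that $E$ has the tracial Rokhlin property: for every nonzero positive $z\in A^\infty$ there is a projection $e\in A'\cap A^\infty$ such that 1. $g=(\operatorname{Index}E)\,E^\infty(e)$ is a projection, 2. $1-g$ is Murray--von Neumann equivalent in $A^\infty$ to a projection in the hereditary subalgebra $\overline{zA^\infty z}$, and 3. the map $A\ni x\mapsto xe\in A^\infty$ is injective. For positive elements $a,b$ of a C*-algebra $B$, write $a\precsim b$ in $B$ if there is a sequence $(x_k)$ in $B$ with $\|x_k^*bx_k-a\|\to0$.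 If $a,b\in P$ are positive and $a\precsim b$ in $A$, then $a\precsim b$ in $P$. -/

import Mathlib

open Filter Topology
open scoped BoundedContinuousFunction

noncomputable section

/-! ### The sequence algebra `A^∞ = ℓ^∞(ℕ, A) / c₀(ℕ, A)` -/

/-- The closed two-sided ideal `c₀(ℕ, A)` of the algebra `ℓ^∞(ℕ, A)` of bounded sequences
(bounded functions on the discrete space `ℕ`). -/
def nullSeq (A : Type*) [CStarAlgebra A] : Ideal (ℕ →ᵇ A) where
  carrier := {x | Tendsto (fun n => ‖x n‖) atTop (𝓝 0)}
  zero_mem' := by simp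
  add_mem' := by
    intro x y hx hy
    refine squeeze_zero (fun _ => norm_nonneg _) (fun n => norm_add_le (x n) (y n)) ?_
    simpa using Tendsto.add hx hy
  smul_mem' := by
    intro c x hx
    refine squeeze_zero (g := fun n => ‖c‖ * ‖x n‖) (fun _ => norm_nonneg _) (fun n => ?_) ?_
    · exact (norm_mul_le (c n) (x n)).trans
        (mul_le_mul_of_nonneg_right (c.norm_coe_le_norm n) (norm_nonneg _))
    · simpa using Tendsto.const_mul ‖c‖ hx

theorem mem_nullSeq {A : Type*} [CStarAlgebra A] {x : ℕ →ᵇ A} :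
    x ∈ nullSeq A ↔ Tendsto (fun n => ‖x n‖) atTop (𝓝 0) := Iff.rfl

instance nullSeq_isTwoSided (A : Type*) [CStarAlgebra A] : (nullSeq A).IsTwoSided where
  mul_mem_of_left := by
    intro x c hx
    refine squeeze_zero (g := fun n => ‖x n‖ * ‖c‖) (fun _ => norm_nonneg _) (fun n => ?_) ?_
    · exact (norm_mul_le (x n) (c n)).trans
        (mul_le_mul_of_nonneg_left (c.norm_coe_le_norm n) (norm_nonneg _))
    · simpa using Tendsto.mul_const ‖c‖ (mem_nullSeq.1 hx)

/-- `A^∞ = ℓ^∞(ℕ, A) / c₀(ℕ, A)`, with the ring structure and the norm (topology) of the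
quotient. -/
abbrev SeqAlg (A : Type*) [CStarAlgebra A] : Type _ := (ℕ →ᵇ A) ⧸ nullSeq A

namespace SeqAlg

variable {A B : Type*} [CStarAlgebra A] [CStarAlgebra B]

/-- The class `[(x_n)]` in `A^∞` of a bounded sequence. -/
def mk (x : ℕ →ᵇ A) : SeqAlg A := Ideal.Quotient.mk (nullSeq A) x

theorem mk_surjective : Function.Surjective (mk : (ℕ →ᵇ A) → SeqAlg A) :=
  Ideal.Quotient.mk_surjective

theorem mk_eq_mk {x y : ℕ →ᵇ A} :
    mk x = mk y ↔ Tendsto (fun n => ‖x n - y n‖) atTop (𝓝 0) :=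
  Ideal.Quotient.eq

/-- The involution `[(x_n)]^* = [(x_n^*)]` makes `A^∞` a star ring. -/
instance : StarRing (SeqAlg A) where
  star := Quotient.map' (fun x => star x) (by
    intro x y h
    refine (Submodule.quotientRel_def _).2 (mem_nullSeq.2 ?_)
    have h' := mem_nullSeq.1 ((Submodule.quotientRel_def _).1 h)
    refine h'.congr fun n => ?_
    change ‖x n - y n‖ = ‖star (x n) - star (y n)‖
    rw [← star_sub, norm_star])
  star_involutive := by
    intro x
    obtain ⟨x, rfl⟩ := mk_surjective x
    exact congrArg mk (star_star x)
  star_mul := by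
    intro x y
    obtain ⟨x, rfl⟩ := mk_surjective x
    obtain ⟨y, rfl⟩ := mk_surjective y
    exact congrArg mk (star_mul x y)
  star_add := by
    intro x y
    obtain ⟨x, rfl⟩ := mk_surjective x
    obtain ⟨y, rfl⟩ := mk_surjective y
    exact congrArg mk (star_add x y)

theorem star_mk (x : ℕ →ᵇ A) : star (mk x) = mk (star x) := rfl

/-- The canonical embedding of `A` into `A^∞` as constant sequences. -/
def const (a : A) : SeqAlg A := mk (BoundedContinuousFunction.const ℕ a)

/-- The map `T^∞ : A^∞ → B^∞`, `[(x_n)] ↦ [(T x_n)]`, induced by a bounded linear map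
`T : A → B`. -/
def map (T : A →L[ℂ] B) : SeqAlg A → SeqAlg B :=
  Quotient.map' (fun x => T.compLeftContinuousBounded ℕ x) (by
    intro x y h
    refine (Submodule.quotientRel_def _).2 (mem_nullSeq.2 ?_)
    have h' := mem_nullSeq.1 ((Submodule.quotientRel_def _).1 h)
    refine squeeze_zero (g := fun n => ‖T‖ * ‖x n - y n‖) (fun _ => norm_nonneg _)
      (fun n => ?_) (by simpa using h'.const_mul ‖T‖)
    change ‖T (x n) - T (y n)‖ ≤ _
    rw [← map_sub]
    exact T.le_opNorm _)

theorem map_mk (T : A →L[ℂ] B) (x : ℕ →ᵇ A) :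
    map T (mk x) = mk (T.compLeftContinuousBounded ℕ x) := rfl

end SeqAlg

/-! ### Murray–von Neumann and Cuntz comparison, hereditary subalgebras -/

/-- Murray–von Neumann equivalence: `p = v^* v` and `q = v v^*` for some `v`. -/
def MurrayVonNeumannEquiv {B : Type*} [Mul B] [Star B] (p q : B) : Prop :=
  ∃ v : B, star v * v = p ∧ v * star v = q

/-- The hereditary C*-subalgebra generated by a positive element `z`: the norm closure of
`z B z`. -/
def hereditarySubalgebra {B : Type*} [Mul B] [TopologicalSpace B] (z : B) : Set B :=
  closure {y | ∃ x : B, y = z * x * z}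

/-- Cuntz subequivalence `a ≾ b` in `B`: there is a sequence `x_k` in `B` with
`x_k^* b x_k → a`. -/
def CuntzSubequiv {B : Type*} [Mul B] [Star B] [TopologicalSpace B] (a b : B) : Prop :=
  ∃ x : ℕ → B, Tendsto (fun k => star (x k) * b * x k) atTop (𝓝 a)

/-! ### Conditional expectations, index, and the tracial Rokhlin property -/

/-- A conditional expectation `E : A → P` onto a unital *-subalgebra `P` of `A`: a positive
contractive linear `P`-bimodule map restricting to the identity on `P`. -/
structure ConditionalExpectation {A : Type*} [CStarAlgebra A] [PartialOrder A]
    [StarOrderedRing A] (P : StarSubalgebra ℂ A) where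
  /-- the underlying bounded linear map -/
  toCLM : A →L[ℂ] P
  map_coe : ∀ p : P, toCLM (p : A) = p
  map_mul_left : ∀ (p : P) (x : A), toCLM ((p : A) * x) = p * toCLM x
  map_mul_right : ∀ (x : A) (p : P), toCLM (x * (p : A)) = toCLM x * p
  map_nonneg : ∀ x : A, 0 ≤ x → 0 ≤ (toCLM x : A)
  norm_map_le : ∀ x : A, ‖toCLM x‖ ≤ ‖x‖

namespace ConditionalExpectation

variable {A : Type*} [CStarAlgebra A] [PartialOrder A] [StarOrderedRing A]
  {P : StarSubalgebra ℂ A}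

/-- `E` regarded as a bounded linear map from `A` to `A` with range `P`. -/
def toSelf (E : ConditionalExpectation P) : A →L[ℂ] A :=
  P.toSubalgebra.toSubmodule.subtypeL.comp E.toCLM

theorem toSelf_apply (E : ConditionalExpectation P) (x : A) : E.toSelf x = (E.toCLM x : A) :=
  rfl

/-- A finite family `(u_i, v_i)` in `A × A` is a quasi-basis for `E` if
`x = ∑ u_i E(v_i x) = ∑ E(x u_i) v_i` for all `x ∈ A`. -/
def IsQuasiBasis (E : ConditionalExpectation P) {n : ℕ} (u v : Fin n → A) : Prop :=
  ∀ x : A, ∑ i, u i * E.toSelf (v i * x) = x ∧ ∑ i, E.toSelf (x * u i) * v i = x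

/-- `E` is of index-finite type (in the sense of Watatani) if it has a quasi-basis. -/
def IndexFiniteType (E : ConditionalExpectation P) : Prop :=
  ∃ (n : ℕ) (u v : Fin n → A), E.IsQuasiBasis u v

/-- `Index E = ∑ u_i v_i` for a quasi-basis `(u_i, v_i)` (and `0` if there is none);
see `index_eq` for the independence of the choice. -/
def index (E : ConditionalExpectation P) : A :=
  open Classical in
  if h : E.IndexFiniteType then
    ∑ i, h.choose_spec.choose i * h.choose_spec.choose_spec.choose i
  else 0

theorem IsQuasiBasis.sum_eq {E : ConditionalExpectation P} {n m : ℕ} {u v : Fin n → A}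
    {s t : Fin m → A} (h : E.IsQuasiBasis u v) (k : E.IsQuasiBasis s t) :
    ∑ i, u i * v i = ∑ j, s j * t j := by
  calc ∑ i, u i * v i = ∑ i, u i * ∑ j, E.toSelf (v i * s j) * t j :=
        Finset.sum_congr rfl fun i _ => by rw [(k (v i)).2]
    _ = ∑ j, (∑ i, u i * E.toSelf (v i * s j)) * t j := by
        simp only [Finset.mul_sum, Finset.sum_mul, mul_assoc]
        exact Finset.sum_comm
    _ = ∑ j, s j * t j := Finset.sum_congr rfl fun j _ => by rw [(h (s j)).1]

/-- The index does not depend on the quasi-basis. -/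
theorem index_eq {E : ConditionalExpectation P} {n : ℕ} {u v : Fin n → A}
    (h : E.IsQuasiBasis u v) : E.index = ∑ i, u i * v i := by
  have hE : E.IndexFiniteType := ⟨n, u, v, h⟩
  rw [index, dif_pos hE]
  exact hE.choose_spec.choose_spec.choose_spec.sum_eq h

/-- `E` has the tracial Rokhlin property: for every nonzero positive `z ∈ A^∞` there is a
projection `e ∈ A' ∩ A^∞` such that `g = (Index E) E^∞(e)` is a projection, `1 - g` is
Murray–von Neumann equivalent to a projection in the hereditary subalgebra of `A^∞` generated
by `z`, and `A ∋ x ↦ x e` is injective. Positive elements of `A^∞` are those of the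
form `y^* y`. -/
def TracialRokhlinProperty (E : ConditionalExpectation P) : Prop :=
  ∀ z : SeqAlg A, z ≠ 0 → (∃ y : SeqAlg A, z = star y * y) →
    ∃ e : SeqAlg A, IsStarProjection e ∧
      (∀ x : A, SeqAlg.const x * e = e * SeqAlg.const x) ∧
      ∃ g : SeqAlg A, g = SeqAlg.const E.index * SeqAlg.map E.toSelf e ∧
        IsStarProjection g ∧
        (∃ q ∈ hereditarySubalgebra z, IsStarProjection q ∧ MurrayVonNeumannEquiv (1 - g) q) ∧
        Function.Injective fun x : A => SeqAlg.const x * e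

end ConditionalExpectation

end

/-! The tracial Rokhlin property quantifies over every nonzero positive `z` in `A^∞`, including
sequences with infinitely many zero entries. Along a subsequence where `z` vanishes, so does
everything in its hereditary subalgebra, hence also `1 - g`. Restricting `e` to that subsequence
gives a genuine Rokhlin projection, `J E^∞(e) = 1` with `J = Index E` (`exists_projection`).

Then `J` is central and invertible and lies in `P`, so `β(x) = J E^∞(e x)` maps `A` into `P^∞`. It
fixes `P`, and `e x = e β(x)` (`rokhlin_mul_const`), whence `β(x)⋆ b β(x) = β(x⋆ b x)` for `b ∈ P`.
Applying `β` to `x_k⋆ b x_k → a` and taking entries of a representative gives the comparison in `P`.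

The identity `e x = e β(x)` comes from a vanishing sum of positive elements, which requires a
quasi-basis `(wᵢ, wᵢ⋆)`; this is obtained from a square root of the Gram matrix `E(uᵢ⋆ uⱼ)`. -/

/-! ### Positivity and square roots of matrices over a C⋆-algebra -/

theorem CStarAlgebra.exists_eq_star_mul_self_of_spectrum_nonneg {B : Type*} [CStarAlgebra B] {x : B}
    (hx : IsSelfAdjoint x) (h : ∀ r ∈ spectrum ℝ x, 0 ≤ r) : ∃ s, x = star s * s := by
  let _ := CStarAlgebra.spectralOrder B
  have := CStarAlgebra.spectralOrderedRing B
  exact CStarAlgebra.nonneg_iff_eq_star_mul_self.1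
    ((StarOrderedRing.nonneg_iff_spectrum_nonneg (R := ℝ) x hx).2 h)

/-- A self-adjoint element of a C⋆-algebra with no strictly negative compression has a self-adjoint
square root. -/
theorem CStarAlgebra.exists_sqrt_of_compression {B : Type*} [CStarAlgebra B] {M : B}
    (hM : IsSelfAdjoint M) (h : ∀ T R : B, star T * M * T = -(star R * R) → R = 0) :
    ∃ N : B, star N = N ∧ N * N = M := by
  let _ := CStarAlgebra.spectralOrder B
  have := CStarAlgebra.spectralOrderedRing B
  have hT0 : 0 ≤ M⁻ := CFC.negPart_nonneg M
  have hTs : star M⁻ = M⁻ := hT0.isSelfAdjoint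
  have hSs : star (CFC.sqrt M⁻) = CFC.sqrt M⁻ := (CFC.sqrt_nonneg M⁻).isSelfAdjoint
  have hSS : CFC.sqrt M⁻ * CFC.sqrt M⁻ = M⁻ := CFC.sqrt_mul_sqrt_self M⁻ hT0
  -- Compressing by the negative part itself leaves `-(M⁻)³`, so the hypothesis forces `M⁻ = 0`.
  have hTMT : star M⁻ * M * M⁻ = -(star (CFC.sqrt M⁻ * M⁻) * (CFC.sqrt M⁻ * M⁻)) := by
    have h1 : M * M⁻ = -(M⁻ * M⁻) := by
      have h2 := congrArg (· * M⁻) (CFC.posPart_sub_negPart M hM)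
      simpa only [sub_mul, CFC.posPart_mul_negPart, zero_sub] using h2.symm
    rw [mul_assoc, h1, star_mul, hTs, hSs, mul_assoc M⁻ (CFC.sqrt M⁻),
      ← mul_assoc (CFC.sqrt M⁻) (CFC.sqrt M⁻), hSS, mul_neg]
  have hTT : star M⁻ * M⁻ = 0 := by
    rw [hTs]
    nth_rw 1 [← hSS]
    rw [mul_assoc, h _ _ hTMT, mul_zero]
  have hM0 : 0 ≤ M :=
    (CFC.negPart_eq_zero_iff M hM).1 ((CStarRing.star_mul_self_eq_zero_iff _).1 hTT)
  exact ⟨CFC.sqrt M, (CFC.sqrt_nonneg M).isSelfAdjoint, CFC.sqrt_mul_sqrt_self M hM0⟩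

/-- A self-adjoint matrix over a C⋆-algebra `B` whose quadratic form takes positive values on all
vectors with entries in `B` has a self-adjoint square root. -/
theorem CStarMatrix.exists_sqrt_of_quadraticForm_nonneg {B : Type*} [CStarAlgebra B]
    [PartialOrder B] [StarOrderedRing B] {n : Type*} [Fintype n] [DecidableEq n]
    (M : CStarMatrix n n B) (hM : star M = M)
    (h : ∀ p : n → B, 0 ≤ ∑ i, ∑ j, star (p i) * M i j * p j) :
    ∃ N : CStarMatrix n n B, star N = N ∧ N * N = M := by
  refine CStarAlgebra.exists_sqrt_of_compression (B := CStarMatrix n n B) hM fun T R hTR => ?_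
  ext i j
  -- The `j`-th diagonal entry is the quadratic form at the `j`-th column of `T`; it is both
  -- nonnegative and minus a sum of squares, so column `j` of `R` vanishes.
  have h2 : (star T * M * T) j j = ∑ i, ∑ k, star (T i j) * M i k * T k j := by
    simp only [CStarMatrix.mul_apply, CStarMatrix.star_apply, Finset.sum_mul]
    exact Finset.sum_comm
  have h3 : (star R * R) j j = ∑ i, star (R i j) * R i j := by
    rw [CStarMatrix.mul_apply]
    simp only [CStarMatrix.star_apply]
  have h4 := h fun i => T i j
  have h5 : ∑ i, ∑ k, star (T i j) * M i k * T k j = -∑ i, star (R i j) * R i j := by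
    rw [← h2, ← h3]
    exact congrFun (congrFun hTR j) j
  rw [h5, neg_nonneg] at h4
  have h6 := (Finset.sum_eq_zero_iff_of_nonneg fun i _ => star_mul_self_nonneg _).1
    (le_antisymm h4 (Finset.sum_nonneg fun i _ => star_mul_self_nonneg _)) i (Finset.mem_univ i)
  rw [CStarMatrix.zero_apply]
  exact (CStarRing.star_mul_self_eq_zero_iff _).1 h6

/-- A closed star subalgebra of a C⋆-algebra is a star-ordered ring for the induced order. -/
theorem StarSubalgebra.starOrderedRing_of_isClosed {A : Type*} [CStarAlgebra A] [PartialOrder A]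
    [StarOrderedRing A] (P : StarSubalgebra ℂ A) (hP : IsClosed (P : Set A)) :
    StarOrderedRing P := by
  refine StarOrderedRing.of_nonneg_iff' (fun {x y} hxy z => ?_) fun x => ⟨fun hx => ?_, ?_⟩
  · have : (x : A) ≤ y := hxy
    change (z : A) + x ≤ z + y
    gcongr
  · have hx' : 0 ≤ (x : A) := hx
    refine CStarAlgebra.exists_eq_star_mul_self_of_spectrum_nonneg
      (Subtype.ext hx'.isSelfAdjoint) fun r hr => ?_
    refine (StarOrderedRing.nonneg_iff_spectrum_nonneg (R := ℝ) (x : A)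
      hx'.isSelfAdjoint).1 hx' r ?_
    rw [← spectrum.algebraMap_mem_iff ℂ] at hr ⊢
    rwa [← StarSubalgebra.spectrum_eq]
  · rintro ⟨s, rfl⟩
    change (0 : A) ≤ star (s : A) * s
    exact star_mul_self_nonneg _

/-! ### Self-adjoint quasi-bases -/

namespace ConditionalExpectation

variable {A : Type*} [CStarAlgebra A] [PartialOrder A] [StarOrderedRing A]
  {P : StarSubalgebra ℂ A} (E : ConditionalExpectation P)

theorem toSelf_mem (x : A) : E.toSelf x ∈ P := (E.toCLM x).2

theorem toSelf_of_mem {p : A} (hp : p ∈ P) : E.toSelf p = p :=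
  congrArg Subtype.val (E.map_coe ⟨p, hp⟩)

theorem toSelf_mul_left {p : A} (hp : p ∈ P) (x : A) : E.toSelf (p * x) = p * E.toSelf x :=
  congrArg Subtype.val (E.map_mul_left ⟨p, hp⟩ x)

theorem toSelf_mul_right (x : A) {p : A} (hp : p ∈ P) : E.toSelf (x * p) = E.toSelf x * p :=
  congrArg Subtype.val (E.map_mul_right x ⟨p, hp⟩)

theorem toSelf_nonneg {x : A} (hx : 0 ≤ x) : 0 ≤ E.toSelf x := E.map_nonneg x hx

theorem norm_toSelf_le (x : A) : ‖E.toSelf x‖ ≤ ‖x‖ := E.norm_map_le x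

theorem toSelf_star (x : A) : E.toSelf (star x) = star (E.toSelf x) := by
  let F : A →ₚ[ℂ] A := PositiveLinearMap.mk₀ (E.toSelf : A →ₗ[ℂ] A) fun x hx => E.toSelf_nonneg hx
  exact map_star F x

/-- A conditional expectation of index-finite type has a quasi-basis of the form `(wᵢ, wᵢ⋆)`. -/
theorem exists_isQuasiBasis_star (hP : IsClosed (P : Set A)) (hfin : E.IndexFiniteType) :
    ∃ (n : ℕ) (w : Fin n → A), E.IsQuasiBasis w fun i => star (w i) := by
  obtain ⟨n, u, v, h⟩ := hfin
  have := hP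
  have := P.starOrderedRing_of_isClosed hP
  let M : CStarMatrix (Fin n) (Fin n) P :=
    CStarMatrix.ofMatrix fun i j => E.toCLM (star (u i) * u j)
  have hMc (i j : Fin n) : ((M i j : P) : A) = E.toSelf (star (u i) * u j) := rfl
  obtain ⟨N, hNs, hNN⟩ : ∃ N, star N = N ∧ N * N = M := by
    refine M.exists_sqrt_of_quadraticForm_nonneg ?_ fun p => ?_
    · ext i j
      rw [CStarMatrix.star_apply]
      change star (E.toSelf (star (u j) * u i)) = E.toSelf (star (u i) * u j)
      rw [← E.toSelf_star, star_mul, star_star]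
    · change 0 ≤ ((∑ i, ∑ j, star (p i) * M i j * p j : P) : A)
      have : ((∑ i, ∑ j, star (p i) * M i j * p j : P) : A) =
          E.toSelf (star (∑ i, u i * (p i : A)) * ∑ i, u i * (p i : A)) := by
        simp only [star_sum, Finset.sum_mul_sum, map_sum, AddSubmonoidClass.coe_finsetSum]
        refine Finset.sum_congr rfl fun i _ => Finset.sum_congr rfl fun j _ => ?_
        change star (p i : A) * E.toSelf (star (u i) * u j) * (p j : A) = _
        rw [← E.toSelf_mul_left (star_mem (p i).2), ← E.toSelf_mul_right _ (p j).2, star_mul]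
        simp only [mul_assoc]
      rw [this]
      exact E.toSelf_nonneg (star_mul_self_nonneg _)
  have hNs' (i j : Fin n) : star ((N i j : P) : A) = (N j i : P) := by
    conv_rhs => rw [← hNs]
    rfl
  have hNN' (i j : Fin n) : ∑ k, ((N i k : P) : A) * (N k j : P) =
      E.toSelf (star (u i) * u j) := by
    rw [← hMc, ← hNN, CStarMatrix.mul_apply]
    simp
  -- With this choice `∑ wₖ E(wₖ⋆ x) = ∑ vᵢ⋆ E(uᵢ⋆ uⱼ) E(vⱼ x)`, which the two quasi-basis
  -- identities (the second one after taking adjoints) collapse to `x`.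
  let w : Fin n → A := fun k => ∑ j, star (v j) * (N j k : P)
  have hw (k : Fin n) : star (w k) = ∑ j, ((N k j : P) : A) * v j := by
    simp only [w, star_sum, star_mul, star_star, hNs']
  have key (x : A) : ∑ i, w i * E.toSelf (star (w i) * x) = x := by
    have h1 (i : Fin n) : E.toSelf (star (w i) * x) =
        ∑ j, ((N i j : P) : A) * E.toSelf (v j * x) := by
      rw [hw, Finset.sum_mul, map_sum]
      exact Finset.sum_congr rfl fun j _ => by
        rw [mul_assoc, E.toSelf_mul_left (N i j).2]
    have h2 (i : Fin n) : ∑ j, E.toSelf (star (u i) * u j) * E.toSelf (v j * x) =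
        E.toSelf (star (u i) * x) := by
      conv_rhs => rw [← (h x).1, Finset.mul_sum, map_sum]
      exact Finset.sum_congr rfl fun j _ => by
        rw [← mul_assoc, E.toSelf_mul_right _ (E.toSelf_mem _)]
    have h3 : ∑ i, star (v i) * E.toSelf (star (u i) * x) = x := by
      have := congrArg star (h (star x)).2
      simpa only [star_sum, star_mul, ← E.toSelf_star, star_star] using this
    calc ∑ k, w k * E.toSelf (star (w k) * x)
        = ∑ k, ∑ i, ∑ j, star (v i) * (((N i k : P) : A) * (N k j : P)) *
            E.toSelf (v j * x) := by
          refine Finset.sum_congr rfl fun k _ => ?_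
          rw [h1, Finset.sum_mul_sum]
          simp only [mul_assoc]
      _ = ∑ i, ∑ j, star (v i) * (E.toSelf (star (u i) * u j) * E.toSelf (v j * x)) := by
          rw [Finset.sum_comm]
          refine Finset.sum_congr rfl fun i _ => ?_
          rw [Finset.sum_comm]
          refine Finset.sum_congr rfl fun j _ => ?_
          rw [← hNN', ← Finset.sum_mul, ← Finset.mul_sum, mul_assoc]
      _ = x := by simp only [← Finset.mul_sum, h2, h3]
  refine ⟨n, w, fun x => ⟨key x, ?_⟩⟩
  have := congrArg star (key (star x))
  simpa only [star_sum, star_mul, ← E.toSelf_star, star_star] using this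

end ConditionalExpectation

/-! ### The sequence algebra and restriction to subsequences -/

theorem isClosed_nullSeq (A : Type*) [CStarAlgebra A] :
    IsClosed (nullSeq A : Set (ℕ →ᵇ A)) := by
  refine isClosed_of_closure_subset fun x hx => ?_
  refine mem_nullSeq.2 (squeeze_zero_norm' (a := fun n => ‖x n‖) (by simp) ?_)
  rw [Metric.tendsto_atTop]
  intro ε hε
  obtain ⟨y, hy, hxy⟩ := Metric.mem_closure_iff.1 hx (ε / 2) (half_pos hε)
  obtain ⟨N, hN⟩ := Metric.tendsto_atTop.1 (mem_nullSeq.1 hy) (ε / 2) (half_pos hε)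
  refine ⟨N, fun n hn => ?_⟩
  have h1 : ‖y n‖ < ε / 2 := by simpa using hN n hn
  have h2 : ‖x n - y n‖ < ε / 2 := by
    rw [← dist_eq_norm]
    exact (BoundedContinuousFunction.dist_coe_le_dist n).trans_lt hxy
  have h3 : ‖x n‖ ≤ ‖x n - y n‖ + ‖y n‖ := by simpa using norm_add_le (x n - y n) (y n)
  simp only [dist_zero_right, norm_norm]
  linarith

namespace SeqAlg

variable {A : Type*} [CStarAlgebra A]

theorem mk_eq_zero {x : ℕ →ᵇ A} : mk x = 0 ↔ Tendsto (fun n => ‖x n‖) atTop (𝓝 0) := by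
  refine (mk_eq_mk (x := x) (y := 0)).trans ?_
  simp

theorem const_mul (a b : A) : const (a * b) = const a * const b := rfl

theorem star_const (a : A) : star (const a) = const (star a) := rfl

theorem const_sum {ι : Type*} (s : Finset ι) (f : ι → A) :
    const (∑ i ∈ s, f i) = ∑ i ∈ s, const (f i) :=
  map_sum (AddMonoidHom.mk' const fun _ _ => rfl) f s

theorem commute_const {a : A} (ha : ∀ x, Commute a x) (y : SeqAlg A) : Commute (const a) y := by
  obtain ⟨y, rfl⟩ := mk_surjective y
  exact congrArg mk (BoundedContinuousFunction.ext fun n => ha (y n))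

theorem map_add (T : A →L[ℂ] A) (x y : SeqAlg A) : map T (x + y) = map T x + map T y := by
  obtain ⟨x, rfl⟩ := mk_surjective x
  obtain ⟨y, rfl⟩ := mk_surjective y
  exact congrArg mk (BoundedContinuousFunction.ext fun n => T.map_add (x n) (y n))

theorem map_sum {ι : Type*} (T : A →L[ℂ] A) (s : Finset ι) (f : ι → SeqAlg A) :
    map T (∑ i ∈ s, f i) = ∑ i ∈ s, map T (f i) :=
  _root_.map_sum (AddMonoidHom.mk' (map T) (map_add T)) f s

theorem map_const (T : A →L[ℂ] A) (a : A) : map T (const a) = const (T a) := rfl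

/-- Restriction to a subsequence, `[(x_n)] ↦ [(x_{φ(n)})]`. -/
noncomputable def reindex (φ : ℕ → ℕ) (hφ : Tendsto φ atTop atTop) : SeqAlg A → SeqAlg A :=
  Quotient.map' (fun x => x.compContinuous ⟨φ, continuous_of_discreteTopology⟩) (by
    intro x y h
    refine (Submodule.quotientRel_def _).2 (mem_nullSeq.2 ?_)
    exact (mem_nullSeq.1 ((Submodule.quotientRel_def _).1 h)).comp hφ)

section reindex

variable (φ : ℕ → ℕ) (hφ : Tendsto φ atTop atTop)

theorem reindex_mk (x : ℕ →ᵇ A) : reindex φ hφ (mk x) =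
    mk (x.compContinuous ⟨φ, continuous_of_discreteTopology⟩) := rfl

theorem reindex_mul (x y : SeqAlg A) :
    reindex φ hφ (x * y) = reindex φ hφ x * reindex φ hφ y := by
  obtain ⟨x, rfl⟩ := mk_surjective x
  obtain ⟨y, rfl⟩ := mk_surjective y
  rfl

theorem reindex_sub (x y : SeqAlg A) :
    reindex φ hφ (x - y) = reindex φ hφ x - reindex φ hφ y := by
  obtain ⟨x, rfl⟩ := mk_surjective x
  obtain ⟨y, rfl⟩ := mk_surjective y
  rfl

theorem reindex_star (x : SeqAlg A) : reindex φ hφ (star x) = star (reindex φ hφ x) := by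
  obtain ⟨x, rfl⟩ := mk_surjective x
  rfl

theorem reindex_const (a : A) : reindex φ hφ (const a) = const a := rfl

theorem reindex_map (T : A →L[ℂ] A) (x : SeqAlg A) :
    reindex φ hφ (map T x) = map T (reindex φ hφ x) := by
  obtain ⟨x, rfl⟩ := mk_surjective x
  rfl

/-- An element of the hereditary subalgebra generated by `z` vanishes along every subsequence
along which `z` vanishes. -/
theorem reindex_eq_zero_of_mem_hereditarySubalgebra {z q : SeqAlg A}
    (hz : reindex φ hφ z = 0) (hq : q ∈ hereditarySubalgebra z) : reindex φ hφ q = 0 := by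
  have hcl : IsClosed {y : SeqAlg A | reindex φ hφ y = 0} := by
    refine isClosed_coinduced.2 ?_
    have : Continuous fun x : ℕ →ᵇ A =>
        x.compContinuous (⟨φ, continuous_of_discreteTopology⟩ : C(ℕ, ℕ)) :=
      BoundedContinuousFunction.continuous_compContinuous _
    convert (isClosed_nullSeq A).preimage this using 1
    ext x
    exact mk_eq_zero
  refine closure_minimal ?_ hcl hq
  rintro _ ⟨x, rfl⟩
  simp only [Set.mem_ofPred_eq, reindex_mul, hz, zero_mul]

/-- Since `1 - g` is idempotent, `1 - g = (v⋆ v)(v⋆ v) = v⋆ q v`, which vanishes wherever `q` does.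
-/
theorem reindex_eq_one_of_murrayVonNeumann {g q v : SeqAlg A} (hg : IsStarProjection g)
    (hv : star v * v = 1 - g) (hvq : v * star v = q) (hq : reindex φ hφ q = 0) :
    reindex φ hφ g = 1 := by
  have hg1 : 1 - g = star v * q * v := by
    have hidem : (1 - g) * (1 - g) = 1 - g := hg.isIdempotentElem.one_sub.eq
    rw [← hidem, ← hvq, ← hv]
    simp only [mul_assoc]
  have h1 := congrArg (reindex φ hφ) hg1
  rw [reindex_mul, reindex_mul, hq, mul_zero, zero_mul, reindex_sub] at h1
  exact (sub_eq_zero.1 h1).symm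

end reindex

/-- The class of the indicator sequence of the even numbers is a nonzero positive element which
vanishes along the odd numbers. -/
theorem exists_reindex_odd_eq_zero (A : Type*) [CStarAlgebra A] [Nontrivial A]
    (hφ : Tendsto (fun n : ℕ => 2 * n + 1) atTop atTop) :
    ∃ z : SeqAlg A, z ≠ 0 ∧ (∃ y, z = star y * y) ∧ reindex _ hφ z = 0 := by
  classical
  let z : ℕ →ᵇ A := BoundedContinuousFunction.ofNormedAddCommGroupDiscrete
    (fun n => if Even n then (1 : A) else 0) 1 fun n => by split_ifs <;> simp
  have hz (n : ℕ) : z n = if Even n then 1 else 0 := rfl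
  refine ⟨mk z, ?_, ⟨mk z, ?_⟩, ?_⟩
  · rw [Ne, mk_eq_zero]
    intro h
    have h3 := h.comp (tendsto_id.const_mul_atTop' (two_pos : (0 : ℕ) < 2))
    have h4 : ((fun n => ‖z n‖) ∘ fun n : ℕ => 2 * id n) = fun _ => (1 : ℝ) := by
      ext n
      simp [hz]
    rw [h4, tendsto_const_nhds_iff] at h3
    exact one_ne_zero h3
  · have h : z = star z * z := by
      refine BoundedContinuousFunction.ext fun n => ?_
      change z n = star (z n) * z n
      by_cases hn : Even n <;> simp [hz, hn]
    exact congrArg mk h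
  · rw [reindex_mk, mk_eq_zero]
    refine tendsto_const_nhds.congr fun n => ?_
    simp [hz]

/-- Entrywise, each `dᵢ dᵢ⋆` is dominated by the sum, so its norm tends to zero with that of the
sum. -/
theorem eq_zero_of_sum_mul_star_eq_zero [PartialOrder A] [StarOrderedRing A] {ι : Type*}
    [Fintype ι] (d : ι → SeqAlg A) (h : ∑ i, d i * star (d i) = 0) (i : ι) : d i = 0 := by
  choose D hD using fun i => mk_surjective (d i)
  have hS : mk (∑ i, D i * star (D i)) = 0 := by
    rw [← h]
    refine (_root_.map_sum (Ideal.Quotient.mk (nullSeq A)) _ _).trans ?_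
    exact Finset.sum_congr rfl fun i _ => by rw [← hD i]; rfl
  rw [← hD, mk_eq_zero]
  rw [mk_eq_zero] at hS
  have hle (n : ℕ) : ‖D i n‖ * ‖D i n‖ ≤ ‖(∑ i, D i * star (D i)) n‖ := by
    rw [← CStarRing.norm_self_mul_star]
    refine CStarAlgebra.norm_le_norm_of_nonneg_of_le (mul_star_self_nonneg _) ?_
    rw [BoundedContinuousFunction.sum_apply]
    exact Finset.single_le_sum (f := fun j => D j n * star (D j n))
      (fun j _ => mul_star_self_nonneg _) (Finset.mem_univ i)
  have h1 : Tendsto (fun n => ‖D i n‖ * ‖D i n‖) atTop (𝓝 0) :=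
    squeeze_zero (fun n => by positivity) hle hS
  have h2 := (Real.continuous_sqrt.tendsto _).comp h1
  simpa [Function.comp_def, Real.sqrt_mul_self] using h2

end SeqAlg

/-! ### The induced expectation on `A^∞` and the Rokhlin projection -/

namespace ConditionalExpectation

variable {A : Type*} [CStarAlgebra A] [PartialOrder A] [StarOrderedRing A]
  {P : StarSubalgebra ℂ A} (E : ConditionalExpectation P)

theorem map_map_mul (x y : SeqAlg A) :
    SeqAlg.map E.toSelf (SeqAlg.map E.toSelf x * y) =
      SeqAlg.map E.toSelf x * SeqAlg.map E.toSelf y := by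
  obtain ⟨x, rfl⟩ := SeqAlg.mk_surjective x
  obtain ⟨y, rfl⟩ := SeqAlg.mk_surjective y
  exact congrArg SeqAlg.mk (BoundedContinuousFunction.ext fun n =>
    E.toSelf_mul_left (E.toSelf_mem (x n)) (y n))

theorem map_mul_map (x y : SeqAlg A) :
    SeqAlg.map E.toSelf (x * SeqAlg.map E.toSelf y) =
      SeqAlg.map E.toSelf x * SeqAlg.map E.toSelf y := by
  obtain ⟨x, rfl⟩ := SeqAlg.mk_surjective x
  obtain ⟨y, rfl⟩ := SeqAlg.mk_surjective y
  exact congrArg SeqAlg.mk (BoundedContinuousFunction.ext fun n =>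
    E.toSelf_mul_right (x n) (E.toSelf_mem (y n)))

theorem map_mul_const (x : SeqAlg A) {p : A} (hp : p ∈ P) :
    SeqAlg.map E.toSelf (x * SeqAlg.const p) = SeqAlg.map E.toSelf x * SeqAlg.const p := by
  have := E.map_mul_map x (SeqAlg.const p)
  rwa [SeqAlg.map_const, E.toSelf_of_mem hp] at this

theorem map_const_mul {p : A} (hp : p ∈ P) (x : SeqAlg A) :
    SeqAlg.map E.toSelf (SeqAlg.const p * x) = SeqAlg.const p * SeqAlg.map E.toSelf x := by
  have := E.map_map_mul (SeqAlg.const p) x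
  rwa [SeqAlg.map_const, E.toSelf_of_mem hp] at this

theorem map_star (x : SeqAlg A) :
    SeqAlg.map E.toSelf (star x) = star (SeqAlg.map E.toSelf x) := by
  obtain ⟨x, rfl⟩ := SeqAlg.mk_surjective x
  exact congrArg SeqAlg.mk (BoundedContinuousFunction.ext fun n => E.toSelf_star (x n))

/-- A tracial Rokhlin expectation has a Rokhlin projection: applying the tracial Rokhlin property to
the class `z` of the indicator sequence of the even numbers, the defect `1 - g` vanishes along the
odd numbers. -/
theorem TracialRokhlinProperty.exists_projection [Nontrivial A] {E : ConditionalExpectation P}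
    (hE : E.TracialRokhlinProperty) :
    ∃ e : SeqAlg A, IsStarProjection e ∧ (∀ x : A, SeqAlg.const x * e = e * SeqAlg.const x) ∧
      SeqAlg.const E.index * SeqAlg.map E.toSelf e = 1 := by
  have hφ : Tendsto (fun n : ℕ => 2 * n + 1) atTop atTop :=
    tendsto_atTop_mono (fun n => by simp only [id]; lia) tendsto_id
  obtain ⟨z, hz0, hzs, hφz⟩ := SeqAlg.exists_reindex_odd_eq_zero A hφ
  obtain ⟨e, he, hcomm, g, hg, hgp, ⟨q, hq, -, v, hv, hvq⟩, -⟩ := hE z hz0 hzs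
  have hφq := SeqAlg.reindex_eq_zero_of_mem_hereditarySubalgebra _ hφ hφz hq
  have hφg := SeqAlg.reindex_eq_one_of_murrayVonNeumann _ hφ hgp hv hvq hφq
  refine ⟨SeqAlg.reindex _ hφ e, ⟨?_, ?_⟩, fun x => ?_, ?_⟩
  · exact (SeqAlg.reindex_mul _ hφ e e).symm.trans
      (congrArg (SeqAlg.reindex _ hφ) he.isIdempotentElem.eq)
  · exact (SeqAlg.reindex_star _ hφ e).symm.trans
      (congrArg (SeqAlg.reindex _ hφ) he.isSelfAdjoint.star_eq)
  · exact (SeqAlg.reindex_mul _ hφ _ e).symm.trans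
      ((congrArg (SeqAlg.reindex _ hφ) (hcomm x)).trans (SeqAlg.reindex_mul _ hφ e _))
  · refine Eq.trans ?_ ((congrArg (SeqAlg.reindex _ hφ) hg).symm.trans hφg)
    rw [SeqAlg.reindex_mul, SeqAlg.reindex_map, SeqAlg.reindex_const]

end ConditionalExpectation

/-! ### The index and the map `β` -/

namespace ConditionalExpectation

variable {A : Type*} [CStarAlgebra A] [PartialOrder A] [StarOrderedRing A]
  {P : StarSubalgebra ℂ A} {E : ConditionalExpectation P}

/-- Both products equal `∑ uⱼ E(vⱼ x uᵢ) vᵢ`, by expanding `vⱼ x` on one side and `x uᵢ` on the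
other. -/
theorem IsQuasiBasis.commute_index {n : ℕ} {u v : Fin n → A} (h : E.IsQuasiBasis u v) (x : A) :
    Commute E.index x := by
  rw [index_eq h]
  change (∑ i, u i * v i) * x = x * ∑ i, u i * v i
  calc (∑ i, u i * v i) * x = ∑ j, u j * ∑ i, E.toSelf (v j * x * u i) * v i := by
        rw [Finset.sum_mul]
        exact Finset.sum_congr rfl fun j _ => by rw [(h (v j * x)).2, mul_assoc]
    _ = ∑ i, (∑ j, u j * E.toSelf (v j * (x * u i))) * v i := by
        simp only [Finset.mul_sum, Finset.sum_mul, mul_assoc]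
        exact Finset.sum_comm
    _ = x * ∑ i, u i * v i := by
        rw [Finset.mul_sum]
        exact Finset.sum_congr rfl fun i _ => by rw [(h (x * u i)).1, mul_assoc]

theorem IsQuasiBasis.star_index {n : ℕ} {w : Fin n → A}
    (h : E.IsQuasiBasis w fun i => star (w i)) : star E.index = E.index := by
  rw [index_eq h, star_sum]
  simp only [star_mul, star_star]

theorem IsQuasiBasis.sum_const_mul_map {n : ℕ} {u v : Fin n → A} (h : E.IsQuasiBasis u v)
    (y : SeqAlg A) :
    ∑ i, SeqAlg.const (u i) * SeqAlg.map E.toSelf (SeqAlg.const (v i) * y) = y := by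
  obtain ⟨y, rfl⟩ := SeqAlg.mk_surjective y
  refine (map_sum (Ideal.Quotient.mk (nullSeq A)) (fun i => BoundedContinuousFunction.const ℕ (u i) *
    E.toSelf.compLeftContinuousBounded ℕ (BoundedContinuousFunction.const ℕ (v i) * y))
    Finset.univ).symm.trans ?_
  refine congrArg SeqAlg.mk (BoundedContinuousFunction.ext fun n => ?_)
  rw [BoundedContinuousFunction.sum_apply]
  exact (h (y n)).1

theorem IsQuasiBasis.sum_map_mul_const {n : ℕ} {u v : Fin n → A} (h : E.IsQuasiBasis u v)
    (y : SeqAlg A) :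
    ∑ i, SeqAlg.map E.toSelf (y * SeqAlg.const (u i)) * SeqAlg.const (v i) = y := by
  obtain ⟨y, rfl⟩ := SeqAlg.mk_surjective y
  refine (map_sum (Ideal.Quotient.mk (nullSeq A)) (fun i =>
    E.toSelf.compLeftContinuousBounded ℕ (y * BoundedContinuousFunction.const ℕ (u i)) *
      BoundedContinuousFunction.const ℕ (v i)) Finset.univ).symm.trans ?_
  refine congrArg SeqAlg.mk (BoundedContinuousFunction.ext fun n => ?_)
  rw [BoundedContinuousFunction.sum_apply]
  exact (h (y n)).2

/-- In the presence of a Rokhlin projection the index lies in `P`. -/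
theorem index_mem_of_rokhlin (hP : IsClosed (P : Set A)) (hI : ∀ x, Commute E.index x)
    {e : SeqAlg A} (he : SeqAlg.const E.index * SeqAlg.map E.toSelf e = 1) : E.index ∈ P := by
  obtain ⟨x, rfl⟩ := SeqAlg.mk_surjective e
  have hlim : Tendsto (fun n => E.index * E.toSelf (x n)) atTop (𝓝 1) := by
    rw [tendsto_iff_norm_sub_tendsto_zero]
    exact SeqAlg.mk_eq_mk.1 he
  -- `J E(xₙ)` is eventually close to `1`, hence invertible, and its factors commute. So `E(xₙ) →
  -- J⁻¹`, and `J⁻¹ ∈ P` because `P` is closed.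
  have hunit : IsUnit E.index := by
    obtain ⟨n, hn⟩ := (hlim.eventually (Units.isOpen.mem_nhds isUnit_one)).exists
    exact ((hI (E.toSelf (x n))).isUnit_mul_iff.1 hn).1
  obtain ⟨J, hJ⟩ := hunit
  have hJlim : Tendsto (fun n => E.toSelf (x n)) atTop (𝓝 (↑J⁻¹ : A)) := by
    have := hlim.const_mul (↑J⁻¹ : A)
    rw [mul_one] at this
    refine this.congr fun n => ?_
    rw [← hJ, Units.inv_mul_cancel_left]
  have hJP : (↑J⁻¹ : A) ∈ P :=
    hP.mem_of_tendsto hJlim (Eventually.of_forall fun n => E.toSelf_mem (x n))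
  have h1 : E.toSelf E.index * (↑J⁻¹ : A) = 1 := by
    rw [← E.toSelf_mul_right _ hJP, ← hJ, Units.mul_inv, E.toSelf_of_mem (one_mem P)]
  have h2 : E.toSelf E.index = E.index := by
    rw [← hJ] at h1 ⊢
    exact Units.mul_inv_eq_one.1 h1
  rw [← h2]
  exact E.toSelf_mem _

/-- The Rokhlin projection `e` satisfies `e x = (Index E) e E^∞(e x)` for `x ∈ A`. -/
theorem IsQuasiBasis.rokhlin_mul_const {n : ℕ} {w : Fin n → A}
    (h : E.IsQuasiBasis w fun i => star (w i)) {e : SeqAlg A} (hep : IsStarProjection e)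
    (he : SeqAlg.const E.index * SeqAlg.map E.toSelf e = 1) (x : A) :
    e * SeqAlg.const x =
      e * (SeqAlg.const E.index * SeqAlg.map E.toSelf (e * SeqAlg.const x)) := by
  have hee : e * e = e := hep.isIdempotentElem.eq
  have hes : star e = e := hep.isSelfAdjoint.star_eq
  set J := SeqAlg.const E.index with hJ
  have hJc (y : SeqAlg A) : J * y = y * J := SeqAlg.commute_const h.commute_index y
  have hJs : star J = J := by rw [hJ, SeqAlg.star_const, h.star_index]
  set W : Fin n → SeqAlg A := fun i => SeqAlg.const (w i)
  set X : Fin n → SeqAlg A := fun i => SeqAlg.map E.toSelf (e * W i) with hX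
  have hXs (i : Fin n) : star (X i) = SeqAlg.map E.toSelf (star (W i) * e) := by
    simp only [hX]
    rw [← E.map_star, star_mul, hes]
  have hWW : ∑ i, W i * star (W i) = J := by
    rw [hJ, index_eq h, SeqAlg.const_sum]
    rfl
  have hWX : ∑ i, W i * star (X i) = e := by
    simp only [hXs]
    exact h.sum_const_mul_map e
  have hXW : ∑ i, X i * star (W i) = e := h.sum_map_mul_const e
  have hXX : ∑ i, X i * star (X i) = SeqAlg.map E.toSelf e := by
    have h1 (i : Fin n) : X i * star (X i) = SeqAlg.map E.toSelf (e * (W i * star (X i))) := by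
      rw [hXs, ← mul_assoc, E.map_mul_map]
    simp only [h1]
    rw [← SeqAlg.map_sum, ← Finset.mul_sum, hWX, hee]
  -- With `dᵢ = e (Wᵢ - J Xᵢ)`, the four sums computed above give `∑ dᵢ dᵢ⋆ = e (J - eJ - Je + J) e
  -- = 0`.
  have hd (i : Fin n) : e * (W i - J * X i) = 0 := by
    refine SeqAlg.eq_zero_of_sum_mul_star_eq_zero (fun i => e * (W i - J * X i)) ?_ i
    have h1 (i : Fin n) : e * (W i - J * X i) * star (e * (W i - J * X i)) =
        e * (W i * star (W i) - W i * star (X i) * J - J * (X i * star (W i)) +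
          J * (X i * star (X i)) * J) * e := by
      rw [star_mul, star_sub, star_mul, hJs, hes]
      noncomm_ring
    simp only [h1]
    rw [← Finset.sum_mul, ← Finset.mul_sum, Finset.sum_add_distrib, Finset.sum_sub_distrib,
      Finset.sum_sub_distrib, ← Finset.sum_mul, ← Finset.mul_sum, ← Finset.sum_mul,
      ← Finset.mul_sum, hWW, hWX, hXW, hXX, he, one_mul, ← hJc e, mul_add, mul_sub, mul_sub,
      ← mul_assoc e J e, ← hJc e, mul_assoc J e e, hee]
    noncomm_ring
  have hd' (i : Fin n) : e * W i = e * (J * X i) := by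
    rw [← sub_eq_zero, ← mul_sub, hd]
  -- The coefficients lie in `P`, so right `P`-linearity carries the identity from the `wᵢ` to `x`.
  have hx : SeqAlg.const x = ∑ i, W i * SeqAlg.const (E.toSelf (star (w i) * x)) :=
    (h.sum_const_mul_map (SeqAlg.const x)).symm
  rw [hx, Finset.mul_sum, SeqAlg.map_sum, Finset.mul_sum, Finset.mul_sum]
  refine Finset.sum_congr rfl fun i _ => ?_
  have hXi : SeqAlg.map E.toSelf (e * W i) = X i := rfl
  rw [← mul_assoc, E.map_mul_const _ (E.toSelf_mem _), hXi, hd']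
  simp only [mul_assoc]

/-- The map `β(x) = (Index E) E^∞(x e)` satisfies `β(x)⋆ b β(x) = β(x⋆ b x)` for `b ∈ P`. -/
theorem IsQuasiBasis.rokhlin_star_mul_mul {n : ℕ} {w : Fin n → A}
    (h : E.IsQuasiBasis w fun i => star (w i)) (hI : E.index ∈ P) {e : SeqAlg A}
    (hep : IsStarProjection e) (hcomm : ∀ x : A, SeqAlg.const x * e = e * SeqAlg.const x)
    (he : SeqAlg.const E.index * SeqAlg.map E.toSelf e = 1) (x b : A) (hb : b ∈ P) :
    star (SeqAlg.const E.index * SeqAlg.map E.toSelf (e * SeqAlg.const x)) * SeqAlg.const b *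
        (SeqAlg.const E.index * SeqAlg.map E.toSelf (e * SeqAlg.const x)) =
      SeqAlg.const E.index * SeqAlg.map E.toSelf (e * SeqAlg.const (star x * b * x)) := by
  have hes : star e = e := hep.isSelfAdjoint.star_eq
  have hJc (y : SeqAlg A) : SeqAlg.const E.index * y = y * SeqAlg.const E.index :=
    SeqAlg.commute_const h.commute_index y
  have hβ : SeqAlg.const E.index * SeqAlg.map E.toSelf (e * SeqAlg.const x) =
      SeqAlg.map E.toSelf (SeqAlg.const E.index * (e * SeqAlg.const x)) :=
    (E.map_const_mul hI _).symm
  have hs : star (SeqAlg.const E.index * SeqAlg.map E.toSelf (e * SeqAlg.const x)) =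
      SeqAlg.const E.index * SeqAlg.map E.toSelf (SeqAlg.const (star x) * e) := by
    rw [star_mul, SeqAlg.star_const, h.star_index, ← E.map_star, star_mul, hes, SeqAlg.star_const,
      hJc]
  have key := h.rokhlin_mul_const hep he x
  rw [hs, mul_assoc (SeqAlg.const E.index), mul_assoc (SeqAlg.const E.index),
    ← E.map_mul_const _ hb]
  congr 1
  -- As `J ∈ P`, `β(x)` is in the range of `E^∞` and moves inside it; there `e b β(x) = b e β(x) = b
  -- e x`.
  rw [hβ, ← E.map_mul_map, ← hβ, mul_assoc (SeqAlg.const (star x)), ← hcomm b, mul_assoc,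
    mul_assoc, ← key, ← hcomm x, ← mul_assoc, ← mul_assoc, ← SeqAlg.const_mul,
    ← SeqAlg.const_mul, hcomm]

end ConditionalExpectation

/-! ### Descent of Cuntz comparison to `P` -/

theorem proposition6p2 {A : Type*} [CStarAlgebra A] [PartialOrder A] [StarOrderedRing A]
    (P : StarSubalgebra ℂ A) (hP : IsClosed (P : Set A))
    (E : ConditionalExpectation P) (hfin : E.IndexFiniteType)
    (hE : E.TracialRokhlinProperty)
    (a b : P) (ha : 0 ≤ (a : A)) (hb : 0 ≤ (b : A))
    (hab : CuntzSubequiv (a : A) (b : A)) :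
    CuntzSubequiv a b := by
  rcases subsingleton_or_nontrivial A with hA | hA
  · exact ⟨fun _ => 0, tendsto_const_nhds.congr fun _ => Subsingleton.elim _ _⟩
  obtain ⟨n, w, hw⟩ := E.exists_isQuasiBasis_star hP hfin
  obtain ⟨e, hep, hcomm, he⟩ := hE.exists_projection
  have hI := E.index_mem_of_rokhlin hP hw.commute_index he
  obtain ⟨y, rfl⟩ := SeqAlg.mk_surjective e
  obtain ⟨x, hx⟩ := hab
  -- `β n s` is the `n`-th entry of a representative of `(Index E) E^∞(e s)`
  let β : ℕ → A → P := fun n s => ⟨E.index, hI⟩ * E.toCLM (y n * s)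
  have hβc (n : ℕ) (s : A) : (β n s : A) = E.index * E.toSelf (y n * s) := rfl
  have hβ (s : A) : Tendsto (fun n => ‖star (β n s : A) * b * β n s - β n (star s * b * s)‖)
      atTop (𝓝 0) :=
    SeqAlg.mk_eq_mk.1 (hw.rokhlin_star_mul_mul hI hep hcomm he s b b.2)
  have hβa : Tendsto (fun n => ‖(β n a : A) - a‖) atTop (𝓝 0) := by
    have h1 : SeqAlg.const E.index * SeqAlg.map E.toSelf (SeqAlg.mk y * SeqAlg.const (a : A)) =
        SeqAlg.const (a : A) := by
      rw [E.map_mul_const _ a.2, ← mul_assoc, he, one_mul]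
    exact SeqAlg.mk_eq_mk.1 h1
  -- The Lipschitz constant does not depend on `n`, so `x m` can be fixed before the entry `N` is
  -- chosen.
  have hβn (n : ℕ) (s t : A) : ‖(β n s : A) - β n t‖ ≤ ‖E.index‖ * ‖y‖ * ‖s - t‖ := by
    rw [hβc, hβc, ← mul_sub, ← map_sub, ← mul_sub, mul_assoc]
    refine (norm_mul_le _ _).trans (mul_le_mul_of_nonneg_left ?_ (norm_nonneg _))
    refine (E.norm_toSelf_le _).trans ((norm_mul_le _ _).trans ?_)
    exact mul_le_mul_of_nonneg_right (y.norm_coe_le_norm n) (norm_nonneg _)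
  have hsmall : Tendsto (fun k => ‖E.index‖ * ‖y‖ * ‖star (x k) * b * x k - a‖) atTop (𝓝 0) := by
    simpa using (tendsto_iff_norm_sub_tendsto_zero.1 hx).const_mul (‖E.index‖ * ‖y‖)
  have hex (k : ℕ) : ∃ p : P, ‖star p * b * p - a‖ < 1 / ((k : ℝ) + 1) := by
    have hε : (0 : ℝ) < 1 / ((k : ℝ) + 1) / 3 := by positivity
    obtain ⟨m, hm⟩ := (hsmall.eventually (gt_mem_nhds hε)).exists
    obtain ⟨N, hN1, hN2⟩ :=
      (((hβ (x m)).eventually (gt_mem_nhds hε)).and (hβa.eventually (gt_mem_nhds hε))).exists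
    refine ⟨β N (x m), ?_⟩
    change ‖star (β N (x m) : A) * b * β N (x m) - a‖ < _
    have h1 := (hβn N (star (x m) * b * x m) a).trans_lt hm
    have h2 := norm_sub_le_norm_sub_add_norm_sub (star (β N (x m) : A) * b * β N (x m))
      (β N (star (x m) * b * x m)) (a : A)
    have h3 := norm_sub_le_norm_sub_add_norm_sub (β N (star (x m) * b * x m) : A) (β N a) (a : A)
    linarith
  choose p hp using hex
  refine ⟨p, tendsto_iff_norm_sub_tendsto_zero.2 ?_⟩
  exact squeeze_zero (fun _ => norm_nonneg _) (fun k => (hp k).le)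
    tendsto_one_div_add_atTop_nhds_zero_nat
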